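/- Let $G$ be a finite simple graph with at least one edge. For an edge $e$ let $N[e]$ be the set of all edges of $G$ that share at least one endpoint with $e$ (so $e\in N[e]$). A function $f:E(G)\to\{-1,1\}$ is a signed edge domination function (SEDF) of $G$ if $\sum_{e'\in N[e]}f(e')\ge 1$ for every $e\in E(G)$. The signed edge domination number of $G$ is $$\gamma'_s(G)=\min\Big\{\sum_{e\in E(G)}f(e)\ :\ f\text{ is an SEDF of }G\Big\}.$$ **Theorem.** Let $m,n$ be positive integers with $m\le n$, and let $K_{m,n}$ be the complete bipartite graph with parts of sizes $m$ and $n$. Then: (i) if $m$ and $n$ are even, then $\gamma'_s(K_{m,n})=\min(2m,\,n)$; (ii) if $m$ and $n$ are odd, then $\gamma'_s(K_{m,n})=\min(2m-1,\,n)$; (iii) if $m$ is even and $n$ is odd, then $\gamma'_s(K_{m,n})=\min(3m,\,\max(2m,\,n+1))$; (iv) if $m$ is odd and $n$ is even, then $\gamma'_s(K_{m,n})=\min(3m-1,\,\max(2m,\,n))$. -/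

import Mathlib

namespace SimpleGraph

/-- The closed neighbourhood `N[e]` of an edge `e`: all edges having an endpoint in common with `e`
(in particular `e` itself). -/
def closedEdgeNeighborSet {V : Type*} (G : SimpleGraph V) (e : G.edgeSet) : Set G.edgeSet :=
  {e' | ∃ v : V, v ∈ (e : Sym2 V) ∧ v ∈ (e' : Sym2 V)}

open Classical in
/-- `f` is a signed edge domination function (SEDF) of `G`: it takes values in `{-1, 1}` and its sum
over the closed neighbourhood of every edge is at least `1`. -/
def IsSEDF {V : Type*} [Fintype V] (G : SimpleGraph V) (f : G.edgeSet → ℤ) : Prop :=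
  (∀ e, f e = -1 ∨ f e = 1) ∧
    ∀ e, 1 ≤ ∑ e' ∈ Finset.univ.filter (fun e' => e' ∈ G.closedEdgeNeighborSet e), f e'

open Classical in
/-- The set of total weights of the SEDFs of `G`. -/
def sedfWeights {V : Type*} [Fintype V] (G : SimpleGraph V) : Set ℤ :=
  {w | ∃ f : G.edgeSet → ℤ, G.IsSEDF f ∧ w = ∑ e, f e}

/-- The signed edge domination number of `G`: the least total weight of an SEDF. It is a genuine
minimum, see `isLeast_signedEdgeDominationNumber`. -/
noncomputable def signedEdgeDominationNumber {V : Type*} [Fintype V] (G : SimpleGraph V) : ℤ :=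
  sInf G.sedfWeights

theorem isLeast_signedEdgeDominationNumber {V : Type*} [Fintype V] (G : SimpleGraph V) :
    IsLeast G.sedfWeights G.signedEdgeDominationNumber := by
  classical
  have hne : G.sedfWeights.Nonempty := by
    refine ⟨_, fun _ => 1, ⟨fun _ => Or.inr rfl, fun e => ?_⟩, rfl⟩
    have he : e ∈ Finset.univ.filter (fun e' => e' ∈ G.closedEdgeNeighborSet e) := by
      refine Finset.mem_filter.2 ⟨Finset.mem_univ _, ?_⟩
      obtain ⟨⟨a, b⟩, h⟩ := e
      exact ⟨a, Sym2.mem_mk_left a b, Sym2.mem_mk_left a b⟩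
    have h := Finset.single_le_sum (f := fun _ : G.edgeSet => (1 : ℤ)) (fun _ _ => zero_le_one) he
    convert h
  have hbdd : BddBelow G.sedfWeights := by
    refine ⟨∑ _e : G.edgeSet, (-1 : ℤ), ?_⟩
    rintro w ⟨f, hf, rfl⟩
    refine Finset.sum_le_sum fun e _ => ?_
    rcases hf.1 e with h | h <;> omega
  exact ⟨Int.csInf_mem hne hbdd, fun w hw => csInf_le hbdd hw⟩

end SimpleGraph

/-!
Edges of `K_{m,n}` are positions of an `m × n` matrix, and a signed edge domination function is a
sign matrix `x` with row sums `rᵢ` and column sums `cⱼ` such that `rᵢ + cⱼ - x i j ≥ 1` throughout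
(`SimpleGraph.sedfWeights_completeBipartiteGraph`). The number in question is the least possible
sum `T` of the entries.

**Lower bounds.** If `m + n` is odd, then `rᵢ + cⱼ - x i j` is even, so it is at least `t = 2`;
otherwise put `t = 1`. Summing over a row gives `T ≥ n * t - (n - 1) * rᵢ`. Hence, for every `ρ` of
the parity of `n`, either all row sums are at least `ρ + 2` and `T ≥ m * (ρ + 2)`, or some row sum
is at most `ρ` and `T ≥ n * t - (n - 1) * ρ` (`SimpleGraph.total_ge_or_of_rows`), and likewise for
columns. Taking `ρ ∈ {-1, 0, 1}` yields all the lower bounds.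

**Upper bounds.** In terms of the positions of the entries `1`, one needs zero-one matrices with
given column sums and row sums that are not too small. Filling the columns one after another,
cyclically in the rows, produces column sums `p j` and row sums that are as equal as possible
(`SimpleGraph.exists_balanced_matrix`). Since enlarging row sums only helps, this suffices whenever
the optimum is attained with all `rᵢ + cⱼ` large enough for an entry `+1`
(`SimpleGraph.signedEdgeDominationNumber_le_of_two_column_sums`). In the remaining ranges the
smallest value of `rᵢ + cⱼ` only allows an entry `-1`, so that the rows or columns of small sum
have to follow a fixed pattern (rows `+ … + - … -` in
`SimpleGraph.signedEdgeDominationNumber_le_of_row_pattern`, columns likewise in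
`SimpleGraph.signedEdgeDominationNumber_le_of_column_pattern` and
`SimpleGraph.signedEdgeDominationNumber_le_of_block_pattern`), and balanced matrices fill the rest.
-/

namespace SimpleGraph

/-! ### Sign matrices -/

/-- A sign matrix, indexed by the two parts of a complete bipartite graph, such that row sum plus
column sum minus entry is at least `1` at every position. These are the signed edge domination
functions of the graph, see `sedfWeights_completeBipartiteGraph`. -/
def IsDominatingSignMatrix {α β : Type*} [Fintype α] [Fintype β] (x : α → β → ℤ) : Prop :=
  (∀ i j, x i j = -1 ∨ x i j = 1) ∧ ∀ i j, 1 ≤ ∑ j', x i j' + ∑ i', x i' j - x i j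

/-- The edges of a complete bipartite graph are the pairs of a left and a right vertex. -/
noncomputable def completeBipartiteEdgeEquiv (α β : Type*) :
    α × β ≃ (completeBipartiteGraph α β).edgeSet :=
  Equiv.ofBijective (fun p => ⟨s(Sum.inl p.1, Sum.inr p.2), by simp⟩) <| by
    constructor
    · rintro ⟨a, b⟩ ⟨c, d⟩ h
      simpa using h
    · rintro ⟨⟨u, v⟩, h⟩
      have h' : (completeBipartiteGraph α β).Adj u v := h
      rcases u with a | a <;> rcases v with b | b <;> simp at h'
      · exact ⟨(a, b), rfl⟩
      · exact ⟨(b, a), Subtype.ext Sym2.eq_swap⟩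

theorem mem_closedEdgeNeighborSet_completeBipartiteEdgeEquiv {α β : Type*} (p q : α × β) :
    completeBipartiteEdgeEquiv α β q ∈
        (completeBipartiteGraph α β).closedEdgeNeighborSet (completeBipartiteEdgeEquiv α β p) ↔
      q.1 = p.1 ∨ q.2 = p.2 := by
  obtain ⟨a, b⟩ := p
  obtain ⟨c, d⟩ := q
  simp [closedEdgeNeighborSet, completeBipartiteEdgeEquiv, Equiv.ofBijective, eq_comm]

/-- Summing a matrix over the cross through `(a, b)` counts the entry at `(a, b)` twice in
row sum plus column sum. -/
theorem sum_filter_row_or_column {α β : Type*} [Fintype α] [Fintype β] [DecidableEq α]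
    [DecidableEq β] (x : α → β → ℤ) (a : α) (b : β) :
    ∑ q : α × β with q.1 = a ∨ q.2 = b, x q.1 q.2 = ∑ j, x a j + ∑ i, x i b - x a b := by
  have h : ∀ q : α × β, (if q.1 = a ∨ q.2 = b then x q.1 q.2 else 0) =
      (if q.1 = a then x q.1 q.2 else 0) + (if q.2 = b then x q.1 q.2 else 0) -
        (if q.1 = a then (if q.2 = b then x q.1 q.2 else 0) else 0) := by
    intro q
    by_cases h1 : q.1 = a <;> by_cases h2 : q.2 = b <;> simp [h1, h2]
  rw [Finset.sum_filter, Finset.sum_congr rfl fun q _ => h q, Finset.sum_sub_distrib,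
    Finset.sum_add_distrib]
  simp [Fintype.sum_prod_type, Finset.sum_ite_irrel]

theorem sedfWeights_completeBipartiteGraph (α β : Type*) [Fintype α] [Fintype β] :
    (completeBipartiteGraph α β).sedfWeights =
      {w | ∃ x : α → β → ℤ, IsDominatingSignMatrix x ∧ w = ∑ i, ∑ j, x i j} := by
  classical
  have key : ∀ f : (completeBipartiteGraph α β).edgeSet → ℤ,
      (completeBipartiteGraph α β).IsSEDF f ↔
        IsDominatingSignMatrix fun i j => f (completeBipartiteEdgeEquiv α β (i, j)) := by
    intro f
    refine and_congr ?_ ?_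
    · rw [← (completeBipartiteEdgeEquiv α β).forall_congr_right]
      exact Prod.forall
    · rw [← (completeBipartiteEdgeEquiv α β).forall_congr_right, Prod.forall]
      refine forall₂_congr fun i j => ?_
      rw [← sum_filter_row_or_column fun i j => f (completeBipartiteEdgeEquiv α β (i, j)),
        Finset.sum_filter, Finset.sum_filter, ← (completeBipartiteEdgeEquiv α β).sum_comp]
      simp only [mem_closedEdgeNeighborSet_completeBipartiteEdgeEquiv]
  ext w
  constructor
  · rintro ⟨f, hf, rfl⟩
    refine ⟨_, (key f).1 hf, ?_⟩
    rw [← Fintype.sum_prod_type', (completeBipartiteEdgeEquiv α β).sum_comp]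
  · rintro ⟨x, hx, rfl⟩
    refine ⟨fun e => x ((completeBipartiteEdgeEquiv α β).symm e).1
      ((completeBipartiteEdgeEquiv α β).symm e).2, (key _).2 (by simpa using hx), ?_⟩
    rw [← Fintype.sum_prod_type', ← (completeBipartiteEdgeEquiv α β).sum_comp]
    convert rfl <;> simp

/-! ### Lower bounds -/

theorem even_sum_sub_card_of_sign {ι : Type*} [Fintype ι] (f : ι → ℤ)
    (hf : ∀ i, f i = -1 ∨ f i = 1) : Even (∑ i, f i - Fintype.card ι) := by
  have h : ∑ i, f i - Fintype.card ι = ∑ i, (f i - 1) := by simp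
  rw [h]
  refine Finset.even_sum _ fun i _ => ?_
  rcases hf i with h | h <;> rw [h] <;> decide

/-- Summing `t + x i j ≤ rᵢ + cⱼ` over the row `i` bounds the total weight from below in terms of
that one row sum. -/
theorem mul_sub_le_total_of_row {α β : Type*} [Fintype α] [Fintype β] {x : α → β → ℤ} {t : ℤ}
    (h : ∀ i j, t + x i j ≤ ∑ j', x i j' + ∑ i', x i' j) (i : α) :
    Fintype.card β * t - (Fintype.card β - 1) * ∑ j, x i j ≤ ∑ i, ∑ j, x i j := by
  have h1 := Finset.sum_le_sum fun j (_ : j ∈ Finset.univ) => h i j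
  rw [Finset.sum_add_distrib, Finset.sum_add_distrib, Finset.sum_comm (f := fun j i' => x i' j)]
    at h1
  simp only [Finset.sum_const, Finset.card_univ, nsmul_eq_mul] at h1
  linarith

/-- Either all row sums exceed `ρ`, hence are at least `ρ + 2` by parity, or the row with a sum of
at most `ρ` forces a large total weight. -/
theorem total_ge_or_of_rows {α β : Type*} [Fintype α] [Fintype β] [Nonempty β] {x : α → β → ℤ}
    {t ρ : ℤ} (hx : ∀ i j, x i j = -1 ∨ x i j = 1)
    (h : ∀ i j, t + x i j ≤ ∑ j', x i j' + ∑ i', x i' j) (hρ : Even (ρ - Fintype.card β)) :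
    Fintype.card α * (ρ + 2) ≤ ∑ i, ∑ j, x i j ∨
      Fintype.card β * t - (Fintype.card β - 1) * ρ ≤ ∑ i, ∑ j, x i j := by
  by_cases hr : ∀ i, ρ + 2 ≤ ∑ j, x i j
  · left
    simpa using Finset.card_nsmul_le_sum Finset.univ _ _ fun i _ => hr i
  · right
    push Not at hr
    obtain ⟨i, hi⟩ := hr
    have hle : ∑ j, x i j ≤ ρ := by
      obtain ⟨a, ha⟩ := hρ
      obtain ⟨b, hb⟩ := even_sum_sub_card_of_sign (x i) (hx i)
      omega
    refine le_trans ?_ (mul_sub_le_total_of_row h i)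
    have hβ : (1 : ℤ) ≤ Fintype.card β := by exact_mod_cast Fintype.card_pos (α := β)
    have := mul_le_mul_of_nonneg_left hle (sub_nonneg.2 hβ)
    linarith

theorem total_ge_or_of_columns {α β : Type*} [Fintype α] [Fintype β] [Nonempty α] {x : α → β → ℤ}
    {t ρ : ℤ} (hx : ∀ i j, x i j = -1 ∨ x i j = 1)
    (h : ∀ i j, t + x i j ≤ ∑ j', x i j' + ∑ i', x i' j) (hρ : Even (ρ - Fintype.card α)) :
    Fintype.card β * (ρ + 2) ≤ ∑ i, ∑ j, x i j ∨
      Fintype.card α * t - (Fintype.card α - 1) * ρ ≤ ∑ i, ∑ j, x i j := by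
  rw [Finset.sum_comm]
  exact total_ge_or_of_rows (x := fun j i => x i j) (fun j i => hx i j)
    (fun j i => (h i j).trans_eq (add_comm _ _)) hρ

theorem IsDominatingSignMatrix.one_add_le {α β : Type*} [Fintype α] [Fintype β] {x : α → β → ℤ}
    (hx : IsDominatingSignMatrix x) (i : α) (j : β) :
    1 + x i j ≤ ∑ j', x i j' + ∑ i', x i' j := by
  have := hx.2 i j
  omega

/-- When the parts have sizes of different parity, row sum plus column sum minus entry is even, so
that the bound `1` improves to `2`. -/
theorem IsDominatingSignMatrix.two_add_le {α β : Type*} [Fintype α] [Fintype β] {x : α → β → ℤ}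
    (hx : IsDominatingSignMatrix x) (hodd : Odd (Fintype.card α + Fintype.card β)) (i : α) (j : β) :
    2 + x i j ≤ ∑ j', x i j' + ∑ i', x i' j := by
  have h1 := hx.2 i j
  obtain ⟨a, ha⟩ := even_sum_sub_card_of_sign (x i) (hx.1 i)
  obtain ⟨b, hb⟩ := even_sum_sub_card_of_sign (fun i' => x i' j) fun i' => hx.1 i' j
  obtain ⟨c, hc⟩ := hodd
  rcases hx.1 i j with h | h <;> omega

theorem le_signedEdgeDominationNumber_completeBipartiteGraph {α β : Type*} [Fintype α] [Fintype β]
    {w : ℤ} (h : ∀ x : α → β → ℤ, IsDominatingSignMatrix x → w ≤ ∑ i, ∑ j, x i j) :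
    w ≤ (completeBipartiteGraph α β).signedEdgeDominationNumber := by
  have hmem := (isLeast_signedEdgeDominationNumber (completeBipartiteGraph α β)).1
  rw [sedfWeights_completeBipartiteGraph] at hmem
  obtain ⟨x, hx, hw⟩ := hmem
  exact hw ▸ h x hx

section

open Finset

/-! ### Balanced zero-one matrices -/

theorem sum_range_add_div (k N : ℕ) (hk : 0 < k) : ∑ i ∈ range k, (N + i) / k = N := by
  induction N with
  | zero =>
    refine Finset.sum_eq_zero fun i hi => ?_
    rw [zero_add]
    exact Nat.div_eq_of_lt (Finset.mem_range.1 hi)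
  | succ N ih =>
    have h1 := Finset.sum_range_succ (fun i => (N + i) / k) k
    rw [Finset.sum_range_succ', ih] at h1
    have h2 : (N + k) / k = N / k + 1 := Nat.add_div_right N hk
    have h3 : ∑ i ∈ range k, (N + 1 + i) / k = ∑ i ∈ range k, (N + (i + 1)) / k :=
      Finset.sum_congr rfl fun i _ => by rw [add_assoc, add_comm 1]
    simp only [add_zero] at h1
    omega

/-- A zero-one matrix with `k` rows and prescribed column sums `p j ≤ k` whose row sums are as equal
as possible, the larger ones coming last. It places the ones of all the columns consecutively and
cyclically in the rows. -/
theorem exists_balanced_matrix {k : ℕ} (hk : 0 < k) (n : ℕ) (p : ℕ → ℕ) (hp : ∀ j, p j ≤ k) :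
    ∃ A : ℕ → ℕ → ℕ, (∀ i j, A i j ≤ 1) ∧ (∀ j, ∑ i ∈ range k, A i j = p j) ∧
      ∀ i < k, ∀ Q, k * Q ≤ ∑ j ∈ range n, p j + i → Q ≤ ∑ j ∈ range n, A i j := by
  set S : ℕ → ℕ := fun j => ∑ l ∈ range j, p l with hS
  have hSs : ∀ j, S (j + 1) = S j + p j := fun j => Finset.sum_range_succ _ _
  have hmono : ∀ i j, (S j + i) / k ≤ (S (j + 1) + i) / k := fun i j =>
    Nat.div_le_div_right (by rw [hSs]; omega)
  -- Filled cyclically from the last row upwards, row `i` gets `(N + i) / k` of the first `N` ones.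
  refine ⟨fun i j => (S (j + 1) + i) / k - (S j + i) / k, fun i j => ?_, fun j => ?_,
    fun i hi Q hQ => ?_⟩
  · have h1 : (S (j + 1) + i) / k ≤ (S j + i + k) / k :=
      Nat.div_le_div_right (by have := hp j; rw [hSs]; omega)
    rw [Nat.add_div_right _ hk] at h1
    dsimp only
    omega
  · rw [Finset.sum_tsub_distrib _ fun i _ => hmono i j, sum_range_add_div _ _ hk,
      sum_range_add_div _ _ hk, hSs]
    omega
  · have hm : Monotone fun j => (S j + i) / k := monotone_nat_of_le_succ (hmono i)
    rw [Finset.sum_range_tsub hm n]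
    have h0 : (S 0 + i) / k = 0 := Nat.div_eq_of_lt (by simpa [hS] using hi)
    rw [h0, Nat.sub_zero, Nat.le_div_iff_mul_le hk, mul_comm]
    exact hQ

/-! ### Signed edge domination functions from zero-one matrices -/

theorem sum_fin_two_mul_sub_one (a : ℕ → ℕ) (n : ℕ) :
    ∑ i : Fin n, (2 * (a i : ℤ) - 1) = 2 * (∑ i ∈ range n, a i : ℕ) - n := by
  rw [Fin.sum_univ_eq_sum_range (fun i => 2 * (a i : ℤ) - 1) n]
  simp [Finset.sum_sub_distrib, Finset.mul_sum]

/-- The translation of domination to zero-one matrices: the signs are `2 * A i j - 1`, so a row with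
`R` ones has sum `2 * R - n` and a column with `C` ones has sum `2 * C - m`. -/
theorem signedEdgeDominationNumber_le_of_matrix {m n : ℕ} {A : ℕ → ℕ → ℕ} {w : ℤ}
    (hA : ∀ i j, A i j ≤ 1)
    (hdom : ∀ i < m, ∀ j < n,
      m + n + 2 * A i j ≤ 2 * (∑ j' ∈ range n, A i j' + ∑ i' ∈ range m, A i' j))
    (hw : 2 * (∑ j ∈ range n, ∑ i ∈ range m, A i j : ℕ) - m * n ≤ w) :
    (completeBipartiteGraph (Fin m) (Fin n)).signedEdgeDominationNumber ≤ w := by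
  refine le_trans ((isLeast_signedEdgeDominationNumber _).2 ?_) hw
  rw [sedfWeights_completeBipartiteGraph]
  refine ⟨fun i j => 2 * (A i j : ℤ) - 1, ⟨fun i j => ?_, fun i j => ?_⟩, ?_⟩
  · have := hA i j
    dsimp only
    omega
  · have h := hdom i i.2 j j.2
    rw [sum_fin_two_mul_sub_one (fun j => A i j), sum_fin_two_mul_sub_one (fun i => A i j)]
    push_cast
    zify at h
    linarith
  · rw [Finset.sum_comm (s := (Finset.univ : Finset (Fin m))),
      Finset.sum_congr rfl fun (j : Fin n) _ =>
        sum_fin_two_mul_sub_one (fun i => A i j) m]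
    rw [Finset.sum_sub_distrib, ← Finset.mul_sum,
      Fin.sum_univ_eq_sum_range (fun j => ((∑ i ∈ range m, A i j : ℕ) : ℤ)) n]
    push_cast
    simp [mul_comm]

theorem sum_range_ite_lt {s n : ℕ} (h : s ≤ n) (a b : ℕ) :
    ∑ j ∈ range n, (if j < s then a else b) = s * a + (n - s) * b := by
  obtain ⟨t, rfl⟩ := Nat.exists_eq_add_of_le h
  rw [Finset.sum_range_add,
    Finset.sum_congr rfl fun j hj => if_pos (Finset.mem_range.1 hj),
    Finset.sum_congr rfl fun j _ => if_neg (by omega : ¬ s + j < s)]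
  simp

/-- A balanced matrix with `e` columns of `c + 1` ones and `n - e` columns of `c` ones is dominating
once every row has `Q` ones and `Q`, `c` are large enough. -/
theorem signedEdgeDominationNumber_le_of_two_column_sums {m n e c Q : ℕ} (hm : 0 < m)
    (he : e ≤ n) (hc : c ≤ m) (hc' : 0 < e → c + 1 ≤ m)
    (hQ : m * Q ≤ n * c + e) (h : m + n + 2 ≤ 2 * (Q + c)) :
    (completeBipartiteGraph (Fin m) (Fin n)).signedEdgeDominationNumber
      ≤ 2 * (n * c + e : ℤ) - m * n := by
  have hsum : ∑ j ∈ range n, (if j < e then c + 1 else c) = n * c + e := by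
    obtain ⟨t, rfl⟩ := Nat.exists_eq_add_of_le he
    rw [sum_range_ite_lt he, Nat.add_sub_cancel_left]
    ring
  obtain ⟨A, hA, hcol, hrow⟩ := exists_balanced_matrix hm n (fun j => if j < e then c + 1 else c)
    (fun j => by split_ifs <;> omega)
  rw [hsum] at hrow
  refine signedEdgeDominationNumber_le_of_matrix hA (fun i hi j hj => ?_) ?_
  · have h1 := hrow i hi Q (by omega)
    have h2 := hA i j
    rw [hcol]
    split_ifs <;> omega
  · rw [Finset.sum_congr rfl fun j _ => hcol j, hsum]
    push_cast
    rfl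

/-- The construction with `b` rows that are `+` on the first `s` columns and `-` on the others. The
remaining `a` rows come from a balanced matrix which makes the first `s` column sums equal to `2`
and the others equal to `0`. -/
theorem signedEdgeDominationNumber_le_of_row_pattern {a b μ n s : ℕ} (ha : 0 < a)
    (hab : a + b = 2 * μ) (hb : b ≤ μ) (hs : s ≤ n) (hn : n ≤ 2 * s) (hn' : 2 * s ≤ n + 1)
    (hQ : a * (s + 1) + s * b ≤ n * μ + s) :
    (completeBipartiteGraph (Fin (2 * μ)) (Fin n)).signedEdgeDominationNumber ≤ 2 * s := by
  obtain ⟨t, rfl⟩ := Nat.exists_eq_add_of_le hs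
  obtain ⟨d, rfl⟩ := Nat.exists_eq_add_of_le hb
  obtain ⟨A, hA, hcol, hrow⟩ := exists_balanced_matrix ha (s + t)
    (fun j => if j < s then d + 1 else b + d) (fun j => by split_ifs <;> omega)
  rw [sum_range_ite_lt hs, Nat.add_sub_cancel_left] at hrow
  set B : ℕ → ℕ → ℕ := fun i j => if i < b then (if j < s then 1 else 0) else A (i - b) j with hB
  have hBcol : ∀ j, ∑ i ∈ range (2 * (b + d)), B i j = b + d + if j < s then 1 else 0 := by
    intro j
    rw [← hab, add_comm a b, Finset.sum_range_add,
      Finset.sum_congr rfl fun i hi => if_pos (Finset.mem_range.1 hi),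
      Finset.sum_congr rfl fun i _ => if_neg (by omega : ¬ b + i < b)]
    simp only [Nat.add_sub_cancel_left, hcol]
    split_ifs
    · simp
      omega
    · simp
  refine signedEdgeDominationNumber_le_of_matrix (A := B) (fun i j => ?_) (fun i hi j hj => ?_) ?_
  · have := hA (i - b) j
    simp only [hB]
    split_ifs <;> omega
  · rw [hBcol]
    by_cases hib : i < b
    · simp only [hB, hib, if_true]
      rw [sum_range_ite_lt hs]
      split_ifs <;> omega
    · simp only [hB, hib, if_false]
      have h1 := hrow (i - b) (by omega) (s + 1) (by nlinarith)
      have h2 := hA (i - b) j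
      split_ifs <;> omega
  · rw [Finset.sum_congr rfl fun j _ => hBcol j, Finset.sum_add_distrib, sum_range_ite_lt hs]
    push_cast
    simp
    linarith

theorem sum_range_two_mul_mod_two (a c : ℕ) : ∑ j ∈ range (2 * a), (j + c) % 2 = a := by
  induction a with
  | zero => rfl
  | succ a ih =>
    rw [Nat.mul_succ, Finset.sum_range_succ, Finset.sum_range_succ, ih]
    omega

/-- The construction with a column that is `+` exactly on the last `h` of the `2 * h + 1` rows. This
column and its negative are used `a` times each, which has no effect on the row sums; the other `L`
columns come from a balanced matrix with column sums `1` and at least `Q` entries `+` in each row,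
at least `Q + 1` in the last `h` rows. -/
theorem signedEdgeDominationNumber_le_of_column_pattern {h a L Q : ℕ}
    (hQ : (2 * h + 1) * Q ≤ L * (h + 1))
    (hQ' : (2 * h + 1) * (Q + 1) ≤ L * (h + 1) + (h + 1)) (hL : L + 1 ≤ 2 * Q) :
    (completeBipartiteGraph (Fin (2 * h + 1)) (Fin (L + 2 * a))).signedEdgeDominationNumber
      ≤ L := by
  obtain ⟨A, hA, hcol, hrow⟩ := exists_balanced_matrix (k := 2 * h + 1) (by omega) L
    (fun _ => h + 1) (fun j => by omega)
  simp only [Finset.sum_const, Finset.card_range, smul_eq_mul] at hrow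
  set B : ℕ → ℕ → ℕ := fun i j =>
    if j < L then A i j else (j - L + if i < h + 1 then 0 else 1) % 2 with hB
  have hBrow : ∀ i, ∑ j ∈ range (L + 2 * a), B i j = ∑ j ∈ range L, A i j + a := by
    intro i
    rw [Finset.sum_range_add,
      Finset.sum_congr rfl fun j hj => if_pos (Finset.mem_range.1 hj),
      Finset.sum_congr rfl fun j _ => if_neg (by omega : ¬ L + j < L)]
    simp only [Nat.add_sub_cancel_left, sum_range_two_mul_mod_two]
  have hBcol : ∀ j, ∑ i ∈ range (2 * h + 1), B i j =
      if j < L then h + 1 else h + (j - L) % 2 := by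
    intro j
    by_cases hj : j < L
    · simp only [hB, hj, if_true, hcol]
    · simp only [hB, hj, if_false]
      rw [Finset.sum_congr rfl fun i _ =>
        (apply_ite (fun c => (j - L + c) % 2) (i < h + 1) 0 1),
        sum_range_ite_lt (by omega)]
      have h1 : 2 * h + 1 - (h + 1) = h := by omega
      rw [h1]
      rcases Nat.mod_two_eq_zero_or_one (j - L) with h2 | h2 <;>
        simp [h2, Nat.add_mod]
  refine signedEdgeDominationNumber_le_of_matrix (A := B) (fun i j => ?_) (fun i hi j hj => ?_) ?_
  · have := hA i j
    simp only [hB]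
    split_ifs <;> omega
  · rw [hBrow, hBcol]
    have h1 := hrow i hi Q (by omega)
    have h2 := hA i j
    by_cases hjL : j < L
    · simp only [hB, hjL, if_true]
      omega
    · simp only [hB, hjL, if_false]
      by_cases hih : i < h + 1
      · simp only [hih, if_true]
        omega
      · have h3 := hrow i hi (Q + 1) (by omega)
        simp only [hih, if_false]
        omega
  · have h1 : ∑ j ∈ range (L + 2 * a), (if j < L then h + 1 else h + (j - L) % 2)
        = L * (h + 1) + (2 * a * h + a) := by
      rw [Finset.sum_range_add,
        Finset.sum_congr rfl fun j hj => if_pos (Finset.mem_range.1 hj),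
        Finset.sum_congr rfl fun j _ => if_neg (by omega : ¬ L + j < L)]
      have h2 := sum_range_two_mul_mod_two a 0
      simp only [add_zero] at h2
      simp only [Nat.add_sub_cancel_left]
      rw [Finset.sum_add_distrib (s := range (2 * a)), h2]
      simp
    rw [Finset.sum_congr rfl fun j _ => hBcol j, h1]
    push_cast
    linarith

/-- The construction for `m = 2 * μ` and `n = m + (2 * δ + 1) < 2 * m`. The last `n - m` columns are
`+` on the first `μ` rows and `-` on the others. On the first `m` columns both halves of the rows
are balanced: the upper rows have sum `2 - 2 * δ`, and the lower half completes every column sum to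
`2`. -/
theorem signedEdgeDominationNumber_le_of_block_pattern {μ δ : ℕ} (hδ : δ + 1 ≤ μ) :
    (completeBipartiteGraph (Fin (2 * μ)) (Fin (2 * μ + (2 * δ + 1)))).signedEdgeDominationNumber
      ≤ 2 * (2 * μ : ℤ) := by
  obtain ⟨ε, rfl⟩ := Nat.exists_eq_add_of_le' hδ
  obtain ⟨μ, hμ⟩ : ∃ μ, μ = ε + (δ + 1) := ⟨_, rfl⟩
  rw [← hμ]
  -- The upper half is the transpose of `U`, with `ε + 2 = μ + 1 - δ` ones in each row.
  obtain ⟨U, hU, hUrow, hUcol⟩ := exists_balanced_matrix (k := 2 * μ) (by omega) μ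
    (fun _ => ε + 2) (fun _ => by omega)
  simp only [Finset.sum_const, Finset.card_range, smul_eq_mul] at hUcol
  have hU1 : ∀ j < 2 * μ, 1 ≤ ∑ i ∈ range μ, U j i := fun j hj =>
    hUcol j hj 1 (by nlinarith)
  have hUμ : ∀ j, ∑ i ∈ range μ, U j i ≤ μ := fun j =>
    (Finset.sum_le_sum fun i _ => hU j i).trans (by simp)
  obtain ⟨A, hA, hAcol, hArow⟩ := exists_balanced_matrix (k := μ) (by omega) (2 * μ)
    (fun j => if j < 2 * μ then μ + 1 - ∑ i ∈ range μ, U j i else 0)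
    (fun j => by
      split_ifs with hj
      · have := hU1 j hj
        omega
      · omega)
  have htot : ∑ j ∈ range (2 * μ), (if j < 2 * μ then μ + 1 - ∑ i ∈ range μ, U j i else 0)
      = μ * (μ + 1 + δ) := by
    rw [Finset.sum_congr rfl fun j hj => if_pos (Finset.mem_range.1 hj),
      Finset.sum_tsub_distrib _ fun j _ => (hUμ j).trans (Nat.le_succ μ), Finset.sum_comm,
      Finset.sum_congr rfl fun i _ => hUrow i]
    simp only [Finset.sum_const, Finset.card_range, smul_eq_mul]
    refine Nat.sub_eq_of_eq_add ?_
    rw [hμ, Nat.succ_eq_add_one]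
    ring
  rw [htot] at hArow
  set B : ℕ → ℕ → ℕ := fun i j =>
    if i < μ then (if j < 2 * μ then U j i else 1) else (if j < 2 * μ then A (i - μ) j else 0)
    with hB
  have hBcol : ∀ j, ∑ i ∈ range (2 * μ), B i j = if j < 2 * μ then μ + 1 else μ := by
    intro j
    rw [two_mul μ, Finset.sum_range_add,
      Finset.sum_congr rfl fun i hi => if_pos (Finset.mem_range.1 hi),
      Finset.sum_congr rfl fun i _ => if_neg (by omega : ¬ μ + i < μ), ← two_mul]
    simp only [Nat.add_sub_cancel_left]
    split_ifs with hj
    · have := hUμ j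
      rw [hAcol, if_pos hj]
      omega
    · simp
  have hsplit : ∀ (c : ℕ) (g : ℕ → ℕ), ∑ j ∈ range (2 * μ + (2 * δ + 1)),
      (if j < 2 * μ then g j else c) = ∑ j ∈ range (2 * μ), g j + (2 * δ + 1) * c := by
    intro c g
    rw [Finset.sum_range_add,
      Finset.sum_congr rfl fun j hj => if_pos (Finset.mem_range.1 hj),
      Finset.sum_congr rfl fun j _ => if_neg (by omega : ¬ 2 * μ + j < 2 * μ)]
    simp
  refine signedEdgeDominationNumber_le_of_matrix (A := B) (fun i j => ?_) (fun i hi j hj => ?_) ?_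
  · have h1 := hU j i
    have h2 := hA (i - μ) j
    simp only [hB]
    split_ifs <;> omega
  · rw [hBcol]
    by_cases hiμ : i < μ
    · have h1 := hU j i
      simp only [hB, hiμ, if_true]
      rw [hsplit, hUrow]
      split_ifs <;> omega
    · have h1 := hA (i - μ) j
      have h2 := hArow (i - μ) (by omega) (μ + 1 + δ) (by omega)
      simp only [hB, hiμ, if_false]
      rw [hsplit]
      split_ifs <;> omega
  · rw [Finset.sum_congr rfl fun j _ => hBcol j, hsplit μ fun _ => μ + 1]
    simp only [Finset.sum_const, Finset.card_range, smul_eq_mul]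
    push_cast
    linarith

end

end SimpleGraph

theorem mainTheorem2 (m n : ℕ) (hm : 1 ≤ m) (hmn : m ≤ n) :
    (Even m → Even n →
      (completeBipartiteGraph (Fin m) (Fin n)).signedEdgeDominationNumber
        = min (2 * (m : ℤ)) (n : ℤ)) ∧
    (Odd m → Odd n →
      (completeBipartiteGraph (Fin m) (Fin n)).signedEdgeDominationNumber
        = min (2 * (m : ℤ) - 1) (n : ℤ)) ∧
    (Even m → Odd n →
      (completeBipartiteGraph (Fin m) (Fin n)).signedEdgeDominationNumber
        = min (3 * (m : ℤ)) (max (2 * (m : ℤ)) ((n : ℤ) + 1))) ∧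
    (Odd m → Even n →
      (completeBipartiteGraph (Fin m) (Fin n)).signedEdgeDominationNumber
        = min (3 * (m : ℤ) - 1) (max (2 * (m : ℤ)) (n : ℤ))) := by
  have : Nonempty (Fin m) := ⟨⟨0, hm⟩⟩
  have : Nonempty (Fin n) := ⟨⟨0, hm.trans hmn⟩⟩
  refine ⟨fun h1 h2 => le_antisymm ?_ ?_, fun h1 h2 => le_antisymm ?_ ?_,
    fun h1 h2 => le_antisymm ?_ ?_, fun h1 h2 => le_antisymm ?_ ?_⟩
  · obtain ⟨μ, rfl⟩ := even_iff_exists_two_mul.1 h1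
    obtain ⟨ν, rfl⟩ := even_iff_exists_two_mul.1 h2
    -- `m` column sums `2`, the others `0`, all row sums `2`.
    have hle : (completeBipartiteGraph (Fin (2 * μ)) (Fin (2 * ν))).signedEdgeDominationNumber
        ≤ 2 * (2 * μ : ℕ) := by
      refine (SimpleGraph.signedEdgeDominationNumber_le_of_two_column_sums (e := 2 * μ) (c := μ)
        (Q := ν + 1) hm hmn (by omega) (by omega) (by linarith) (by omega)).trans_eq ?_
      push_cast
      ring
    refine le_min hle ?_
    rcases le_total (2 * ν) (2 * (2 * μ)) with h | h
    -- `a` row sums `2` and `b` row sums `0`: `a + b = m` and `2 * a = n`.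
    · refine (SimpleGraph.signedEdgeDominationNumber_le_of_row_pattern (a := ν) (b := 2 * μ - ν)
        (s := ν) (by omega) (by omega) (by omega) (by omega) (by omega) (by omega) ?_).trans_eq
          (by push_cast; rfl)
      zify [(by omega : ν ≤ 2 * μ)]
      linarith
    · omega
  · refine SimpleGraph.le_signedEdgeDominationNumber_completeBipartiteGraph fun x hx => ?_
    have h := SimpleGraph.total_ge_or_of_rows (ρ := 0) hx.1 hx.one_add_le
      (by simpa using h2)
    simp only [Fintype.card_fin] at h
    omega
  · obtain ⟨h, rfl⟩ := h1
    obtain ⟨g, rfl⟩ := h2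
    -- All column sums `1`, all row sums at least `1` because `m ≤ n`.
    have hle : (completeBipartiteGraph (Fin (2 * h + 1))
        (Fin (2 * g + 1))).signedEdgeDominationNumber ≤ (2 * g + 1 : ℕ) := by
      refine (SimpleGraph.signedEdgeDominationNumber_le_of_two_column_sums (e := 0) (c := h + 1)
        (Q := g + 1) hm (by omega) (by omega) (by omega) (by linarith) (by omega)).trans_eq ?_
      push_cast
      ring
    refine le_min ?_ hle
    rcases le_total (4 * h + 1) (2 * g + 1) with h3 | h3
    -- `h` row sums `3` and `h + 1` row sums `1`, with total `4 * h + 1 = 2 * m - 1`.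
    · obtain ⟨a, ha⟩ : ∃ a, 2 * g + 1 = 4 * h + 1 + 2 * a := ⟨g - 2 * h, by omega⟩
      rw [ha]
      refine (SimpleGraph.signedEdgeDominationNumber_le_of_column_pattern (Q := 2 * h + 1)
        (by nlinarith) (by nlinarith) (by omega)).trans ?_
      push_cast
      linarith
    · omega
  · refine SimpleGraph.le_signedEdgeDominationNumber_completeBipartiteGraph fun x hx => ?_
    have h := SimpleGraph.total_ge_or_of_columns (ρ := -1) hx.1 hx.one_add_le
      (by rw [Fintype.card_fin]; grind)
    simp only [Fintype.card_fin] at h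
    omega
  · obtain ⟨μ, rfl⟩ := even_iff_exists_two_mul.1 h1
    obtain ⟨g, rfl⟩ := h2
    rcases le_or_gt (g + 1) (2 * μ) with h3 | h3
    · obtain ⟨δ, rfl⟩ : ∃ δ, g = μ + δ := ⟨g - μ, by omega⟩
      have h := SimpleGraph.signedEdgeDominationNumber_le_of_block_pattern
        (μ := μ) (δ := δ) (by omega)
      rw [show 2 * (μ + δ) + 1 = 2 * μ + (2 * δ + 1) by ring]
      omega
    rcases le_total (g + 1) (3 * μ) with h4 | h4
    -- `a` row sums `3` and `b` row sums `1`: `a + b = m` and `3 * a + b = n + 1`.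
    · have h := SimpleGraph.signedEdgeDominationNumber_le_of_row_pattern (a := g + 1 - μ)
        (b := 3 * μ - (g + 1)) (μ := μ) (n := 2 * g + 1) (s := g + 1) (by omega) (by omega)
        (by omega) (by omega) (by omega) (by omega) (by
          zify [(by omega : μ ≤ g + 1), h4]
          linarith)
      push_cast at h ⊢
      omega
    -- All row sums `3`, with `3 * m / 2` column sums `2` and the others `0`.
    · have h := SimpleGraph.signedEdgeDominationNumber_le_of_two_column_sums (m := 2 * μ)
        (n := 2 * g + 1) (e := 3 * μ) (c := μ) (Q := g + 2) hm (by omega) (by omega) (by omega)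
        (by linarith) (by omega)
      push_cast at h ⊢
      rw [show (2 : ℤ) * ((2 * g + 1) * μ + 3 * μ) - 2 * μ * (2 * g + 1) = 6 * μ by ring] at h
      omega
  · refine SimpleGraph.le_signedEdgeDominationNumber_completeBipartiteGraph fun x hx => ?_
    have hodd : Odd (Fintype.card (Fin m) + Fintype.card (Fin n)) := by
      simpa using h1.add_odd h2
    have h := SimpleGraph.total_ge_or_of_rows (ρ := 1) hx.1 (hx.two_add_le hodd)
      (by rw [Fintype.card_fin]; grind)
    have h' := SimpleGraph.total_ge_or_of_columns (ρ := 0) hx.1 (hx.two_add_le hodd)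
      (by simpa using h1)
    simp only [Fintype.card_fin] at h h'
    omega
  · obtain ⟨h, rfl⟩ := h1
    obtain ⟨g, rfl⟩ := even_iff_exists_two_mul.1 h2
    rcases le_total g (2 * h + 1) with h3 | h3
    -- All row sums `2`, with `(2 * m - n) / 2` column sums `3` and the others `1`.
    · have h4 := SimpleGraph.signedEdgeDominationNumber_le_of_two_column_sums (m := 2 * h + 1)
        (n := 2 * g) (e := 2 * h + 1 - g) (c := h + 1) (Q := g + 1) hm (by omega) (by omega)
        (by omega) (by zify [h3]; linarith) (by omega)
      push_cast [h3] at h4 ⊢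
      rw [show (2 : ℤ) * (2 * g * (h + 1) + (2 * h + 1 - g)) - (2 * h + 1) * (2 * g)
        = 2 * (2 * h + 1) by ring] at h4
      omega
    rcases le_total g (3 * h + 1) with h5 | h5
    -- All column sums `1`, all row sums at least `2` because `2 * m ≤ n`.
    · have h4 := SimpleGraph.signedEdgeDominationNumber_le_of_two_column_sums (m := 2 * h + 1)
        (n := 2 * g) (e := 0) (c := h + 1) (Q := g + 1) hm (by omega) (by omega)
        (by omega) (by linarith) (by omega)
      push_cast at h4 ⊢
      rw [show (2 : ℤ) * (2 * g * (h + 1) + 0) - (2 * h + 1) * (2 * g) = 2 * g by ring] at h4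
      omega
    -- `h` row sums `4` and `h + 1` row sums `2`, with total `6 * h + 2 = 3 * m - 1`.
    · obtain ⟨a, ha⟩ : ∃ a, 2 * g = 6 * h + 2 + 2 * a := ⟨g - (3 * h + 1), by omega⟩
      have h4 := SimpleGraph.signedEdgeDominationNumber_le_of_column_pattern (h := h) (a := a)
        (L := 6 * h + 2) (Q := 3 * h + 2) (by nlinarith) (by nlinarith) (by omega)
      rw [ha]
      omega
  · refine SimpleGraph.le_signedEdgeDominationNumber_completeBipartiteGraph fun x hx => ?_
    have hodd : Odd (Fintype.card (Fin m) + Fintype.card (Fin n)) := by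
      simpa using h1.add_even h2
    have h := SimpleGraph.total_ge_or_of_columns (ρ := -1) hx.1 (hx.two_add_le hodd)
      (by rw [Fintype.card_fin]; grind)
    have h' := SimpleGraph.total_ge_or_of_rows (ρ := 0) hx.1 (hx.two_add_le hodd)
      (by simpa using h2)
    simp only [Fintype.card_fin] at h h'
    omega
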